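/- For a set $A\subset\mathbb N=\{1,2,\dots\}$ let $\underline{\mathrm{dens}}\,A=\liminf_{N\to\infty}\frac1N\,\mathrm{card}\{n\le N:n\in A\}$ and $\overline{\mathrm{dens}}\,A=\limsup_{N\to\infty}\frac1N\,\mathrm{card}\{n\le N:n\in A\}$. Let $\mathbb K=\mathbb R$ or $\mathbb C$. A continuous linear operator $T$ on $X$ is frequently (resp. upper frequently) hypercyclic if there is $x\in X$, called a frequently (resp. upper frequently) hypercyclic vector for $T$, such that for every non-empty open set $U\subset X$ the set $\{n:T^nx\in U\}$ has positive lower (resp. upper) density. Operators $T_1,\dots,T_N$ on $X$ are disjoint frequently (resp. disjoint upper frequently) hypercyclic if the direct sum $T_1\oplus\cdots\oplus T_N$ on $X^N$ has a frequently (resp. upper frequently) hypercyclic vector of the form $(x,\dots,x)$ with $x\in X$. For a bounded sequence $w=(w_n)_{n\ge1}$ in $\mathbb K$, the unilateral weighted backward shift $B_w$ on $\ell^p(\mathbb N)$ (with scalars in $\mathbb K$) is defined by $B_we_1=0$ and $B_we_n=w_ne_{n-1}$ for $n\ge2$, where $(e_n)_{n\ge 1}$ is the canonical basis. Theorem. For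 each $\mathbb K\in\{\mathbb R,\mathbb C\}$ and each $1\le p<\infty$ there exist bounded weight sequences $v,w$ in $\mathbb K$ such that the weighted shifts $B_v$ and $B_w$ on $\ell^p(\mathbb N)$ are both frequently hypercyclic, and $B_v,B_w$ are disjoint upper frequently hypercyclic but not disjoint frequently hypercyclic. -/

import Mathlib

open scoped ENNReal

/-! ### Densities of sets of natural numbers -/

/-- The lower density `liminf_{N → ∞} card {1 ≤ n ≤ N : n ∈ A} / N`. -/
noncomputable def lowerDensity (A : Set ℕ) : ℝ :=
  Filter.liminf (fun N : ℕ => ((A ∩ Set.Icc 1 N).ncard : ℝ) / (N : ℝ)) Filter.atTop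

/-- The upper density `limsup_{N → ∞} card {1 ≤ n ≤ N : n ∈ A} / N`. -/
noncomputable def upperDensity (A : Set ℕ) : ℝ :=
  Filter.limsup (fun N : ℕ => ((A ∩ Set.Icc 1 N).ncard : ℝ) / (N : ℝ)) Filter.atTop

/-- The family of sets of positive lower density. -/
def posLowerDensity : Set (Set ℕ) := {A | 0 < lowerDensity A}

/-- The family of sets of positive upper density. -/
def posUpperDensity : Set (Set ℕ) := {A | 0 < upperDensity A}

/-! ### Hypercyclicity with respect to a family of sets of natural numbers -/

section Hypercyclicity

variable {𝕜 X : Type*} [NormedField 𝕜] [AddCommGroup X] [Module 𝕜 X] [TopologicalSpace X]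

/-- `x` is an `𝒜`-hypercyclic vector for `T` if `{n : T ^ n x ∈ U} ∈ 𝒜` for every non-empty
open set `U`. -/
def IsFamilyHypercyclicVector (𝒜 : Set (Set ℕ)) (T : X →L[𝕜] X) (x : X) : Prop :=
  ∀ U : Set X, IsOpen U → U.Nonempty → {n : ℕ | (T ^ n) x ∈ U} ∈ 𝒜

/-- `T` is `𝒜`-hypercyclic if it has an `𝒜`-hypercyclic vector. -/
def IsFamilyHypercyclic (𝒜 : Set (Set ℕ)) (T : X →L[𝕜] X) : Prop :=
  ∃ x : X, IsFamilyHypercyclicVector 𝒜 T x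

/-- The direct sum operator `T₁ ⊕ ⋯ ⊕ T_N` on `X ^ N`. -/
def directSumOp {N : ℕ} (T : Fin N → X →L[𝕜] X) : (Fin N → X) →L[𝕜] (Fin N → X) :=
  ContinuousLinearMap.pi fun i => (T i).comp (ContinuousLinearMap.proj i)

/-- `T₁, …, T_N` are disjoint `𝒜`-hypercyclic if `T₁ ⊕ ⋯ ⊕ T_N` has an `𝒜`-hypercyclic vector of
the form `(x, …, x)`. -/
def AreDisjointFamilyHypercyclic (𝒜 : Set (Set ℕ)) {N : ℕ} (T : Fin N → X →L[𝕜] X) : Prop :=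
  ∃ x : X, IsFamilyHypercyclicVector 𝒜 (directSumOp T) (fun _ => x)

/-- Frequent hypercyclicity. -/
def IsFrequentlyHypercyclic (T : X →L[𝕜] X) : Prop :=
  IsFamilyHypercyclic posLowerDensity T

/-- Disjoint frequent hypercyclicity. -/
def AreDisjointFrequentlyHypercyclic {N : ℕ} (T : Fin N → X →L[𝕜] X) : Prop :=
  AreDisjointFamilyHypercyclic posLowerDensity T

/-- Disjoint upper frequent hypercyclicity. -/
def AreDisjointUpperFrequentlyHypercyclic {N : ℕ} (T : Fin N → X →L[𝕜] X) : Prop :=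
  AreDisjointFamilyHypercyclic posUpperDensity T

end Hypercyclicity

/-! ### Unilateral weighted backward shifts on `ℓ^p` -/

section WeightedShift

variable {𝕜 : Type*} [RCLike 𝕜]

theorem norm_weight_mul_le (w : lp (fun _ : ℕ => 𝕜) ∞) (x : ℕ → 𝕜) (n : ℕ) :
    ‖w (n + 1) * x (n + 1)‖ ≤ ‖(‖w‖ : ℝ) • x (n + 1)‖ := by
  rw [norm_mul, norm_smul, norm_norm]
  exact mul_le_mul_of_nonneg_right (lp.norm_apply_le_norm ENNReal.top_ne_zero w (n + 1))
    (norm_nonneg _)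

/-- `x ∈ ℓ^p` implies `(w_{n+1} x_{n+1})_n ∈ ℓ^p`, with norm at most `‖w‖_∞ ‖x‖_p`. -/
theorem memℓp_weightedShift (p : ℝ≥0∞) (hp : 0 < p.toReal) (w : lp (fun _ : ℕ => 𝕜) ∞)
    (x : lp (fun _ : ℕ => 𝕜) p) :
    Memℓp (fun n : ℕ => w (n + 1) * x (n + 1)) p := by
  refine memℓp_gen ?_
  have h := (summable_nat_add_iff 1).2 (((lp.memℓp x).const_smul (‖w‖ : 𝕜)).summable hp)
  refine Summable.of_nonneg_of_le (fun n => by positivity) (fun n => ?_) h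
  refine Real.rpow_le_rpow (norm_nonneg _) ?_ hp.le
  have := norm_weight_mul_le w x n
  simpa [norm_smul] using this

theorem toReal_pos_of_ne_top (p : ℝ≥0∞) [hp1 : Fact (1 ≤ p)] (hp : p ≠ ∞) : 0 < p.toReal :=
  ENNReal.toReal_pos (zero_lt_one.trans_le hp1.out).ne' hp

/-- The unilateral weighted backward shift `B_w` on `ℓ^p`, `1 ≤ p < ∞`, with bounded weight
sequence `w`. The canonical basis is indexed from `0`: `B_w e₀ = 0` and `B_w eₙ = wₙ eₙ₋₁` for
`n ≥ 1`, that is, `(B_w x)ₙ = wₙ₊₁ xₙ₊₁`; the entry `w₀` plays no role. -/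
noncomputable def weightedShift (p : ℝ≥0∞) [Fact (1 ≤ p)] (hp : p ≠ ∞)
    (w : lp (fun _ : ℕ => 𝕜) ∞) :
    lp (fun _ : ℕ => 𝕜) p →L[𝕜] lp (fun _ : ℕ => 𝕜) p :=
  LinearMap.mkContinuous
    { toFun := fun x => ⟨fun n : ℕ => w (n + 1) * x (n + 1),
        memℓp_weightedShift p (toReal_pos_of_ne_top p hp) w x⟩
      map_add' := fun x y => by
        ext n
        exact mul_add (w (n + 1)) (x (n + 1)) (y (n + 1))
      map_smul' := fun c x => by
        ext n
        simp [mul_left_comm] }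
    ‖w‖
    (fun x => by
      have hp0 := toReal_pos_of_ne_top p hp
      refine lp.norm_le_of_tsum_le hp0 (by positivity) ?_
      have h1 := (lp.memℓp ((‖w‖ : 𝕜) • x)).summable hp0
      have h2 : ‖(‖w‖ : 𝕜) • x‖ = ‖w‖ * ‖x‖ := by simp [norm_smul]
      rw [← h2, lp.norm_rpow_eq_tsum hp0, h1.tsum_eq_zero_add]
      refine le_trans ?_ (le_add_of_nonneg_left (by positivity))
      refine Summable.tsum_le_tsum (fun n => ?_)
        ((memℓp_weightedShift p hp0 w x).summable hp0) ((summable_nat_add_iff 1).2 h1)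
      refine Real.rpow_le_rpow (norm_nonneg _) ?_ hp0.le
      have := norm_weight_mul_le w x n
      simpa [norm_smul] using this)

theorem weightedShift_apply (p : ℝ≥0∞) [Fact (1 ≤ p)] (hp : p ≠ ∞)
    (w : lp (fun _ : ℕ => 𝕜) ∞) (x : lp (fun _ : ℕ => 𝕜) p) (n : ℕ) :
    weightedShift p hp w x n = w (n + 1) * x (n + 1) := rfl

theorem weightedShift_single_zero (p : ℝ≥0∞) [Fact (1 ≤ p)] (hp : p ≠ ∞)
    (w : lp (fun _ : ℕ => 𝕜) ∞) :
    weightedShift p hp w (lp.single p 0 1) = 0 := by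
  ext n
  simp [weightedShift_apply]

theorem weightedShift_single_succ (p : ℝ≥0∞) [Fact (1 ≤ p)] (hp : p ≠ ∞)
    (w : lp (fun _ : ℕ => 𝕜) ∞) (n : ℕ) :
    weightedShift p hp w (lp.single p (n + 1) 1) = w (n + 1) • lp.single p n 1 := by
  ext m
  by_cases h : m = n
  · subst h
    simp [weightedShift_apply]
  · simp [weightedShift_apply, h]

end WeightedShift

/-! Write the weights as `v (i + 1) = V (i + 1) / V i`. Then the `j`-th coordinate of the `n`-th
iterate of `x` is `V (n + j) * x (n + j) / V j`. If `‖V j‖ ≥ 16 ^ j / 16`, the iterate is close to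
`y` as soon as the scalar sequence `V * x` nearly reproduces `V 0 * y 0, …, V (m - 1) * y (m - 1)`
from position `n` on and is then at most `2 ^ k` at distance `k` (`norm_weightedShift_pow_sub_lt`).

Sequences with this property are built symbolically. Over a countable alphabet dense in the scalars,
some `σ` contains every finite word with positive frequency, followed by letters of controlled size
(`exists_sequence_frequent_words`). As all words occur, `σ` can be chosen before `V`, and each shift
with such a `V` is frequently hypercyclic.

For the pair, let `τ` equal `σ`, a sequence of pairs of letters, on `factorialWindows` and a trivial
pair elsewhere. Put `V = s * D` and `W = t * D`, where `s`, `t` are the scalars read from the two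
components of `τ` and `D` is a common factor. Then `x = 1 / D` gives `V * x = s` and `W * x = t`, so
the joint orbit follows `σ` inside the windows, which have large proportion along a subsequence:
this gives upper frequency. Outside the windows `V = W`, so for every `x` the two orbits then share
their zeroth coordinate and cannot be near `(e₀, 2 e₀)`. The windows have lower density zero, which
excludes disjoint frequent hypercyclicity. -/

/-! ### Sequences containing every finite word frequently -/

section Words

/-- The concatenation of the first `k` blocks of a sequence of words. -/
def concatBlocks {α : Type*} (B : ℕ → List α) : ℕ → List α
  | 0 => []
  | k + 1 => concatBlocks B k ++ B k

variable {α : Type*}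

theorem concatBlocks_prefix (B : ℕ → List α) {k l : ℕ} (h : k ≤ l) :
    concatBlocks B k <+: concatBlocks B l := by
  induction l, h using Nat.le_induction with
  | base => exact List.prefix_refl _
  | succ l _ ih => exact ih.trans (List.prefix_append _ _)

theorem le_length_concatBlocks {B : ℕ → List α} (hB : ∀ k, B k ≠ []) (k : ℕ) :
    k ≤ (concatBlocks B k).length := by
  induction k with
  | zero => simp
  | succ k ih =>
    have := List.length_pos_iff.2 (hB k)
    simp only [concatBlocks, List.length_append]
    omega

/-- The infinite concatenation of a sequence of words. -/
def concatSeq (B : ℕ → List α) (a₀ : α) (i : ℕ) : α :=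
  (concatBlocks B (i + 1)).getD i a₀

theorem concatSeq_eq {B : ℕ → List α} (hB : ∀ k, B k ≠ []) (a₀ : α) {k i : ℕ}
    (hi : i < (concatBlocks B k).length) :
    concatSeq B a₀ i = (concatBlocks B k)[i] := by
  have h1 : i < (concatBlocks B (i + 1)).length := le_length_concatBlocks hB (i + 1)
  rw [concatSeq, List.getD_eq_getElem _ _ h1]
  rcases le_total k (i + 1) with h | h
  · exact ((concatBlocks_prefix B h).getElem hi).symm
  · exact (concatBlocks_prefix B h).getElem h1

theorem concatSeq_length_add {B : ℕ → List α} (hB : ∀ k, B k ≠ []) (a₀ : α) (k : ℕ) {i : ℕ}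
    (hi : i < (B k).length) :
    concatSeq B a₀ ((concatBlocks B k).length + i) = (B k)[i] := by
  have h : (concatBlocks B k).length + i < (concatBlocks B (k + 1)).length := by
    simp only [concatBlocks, List.length_append]; omega
  rw [concatSeq_eq hB a₀ h]
  simp [concatBlocks]

theorem sum_concatBlocks (B : ℕ → List α) (β : α → ℕ) (k : ℕ) :
    ((concatBlocks B k).map β).sum = ∑ i ∈ Finset.range k, ((B i).map β).sum := by
  induction k with
  | zero => simp [concatBlocks]
  | succ k ih => simp [concatBlocks, ih, Finset.sum_range_succ]

theorem length_concatBlocks (B : ℕ → List α) (k : ℕ) :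
    (concatBlocks B k).length = ∑ i ∈ Finset.range k, (B i).length := by
  induction k with
  | zero => simp [concatBlocks]
  | succ k ih => simp [concatBlocks, ih, Finset.sum_range_succ]

theorem sum_concatSeq_le {B : ℕ → List α} (hB : ∀ k, B k ≠ []) (a₀ : α) (β : α → ℕ) (N : ℕ) :
    ∑ i ∈ Finset.range N, β (concatSeq B a₀ i) ≤ ∑ i ∈ Finset.range N, ((B i).map β).sum := by
  rw [← sum_concatBlocks]
  have hN := le_length_concatBlocks hB N
  have : ∀ i : Fin (concatBlocks B N).length,
      β (concatBlocks B N)[i] = β (concatSeq B a₀ i) := fun i => by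
    rw [concatSeq_eq hB a₀ i.2]; rfl
  have h2 : ((concatBlocks B N).map β).sum
      = ∑ i ∈ Finset.range (concatBlocks B N).length, β (concatSeq B a₀ i) := by
    rw [← Fin.sum_univ_eq_sum_range (fun i => β (concatSeq B a₀ i)), ← Fin.sum_univ_fun_getElem]
    exact Finset.sum_congr rfl fun i _ => this i
  rw [h2]
  exact Finset.sum_le_sum_of_subset (Finset.range_mono hN)

/-- A letter's size is at most its position in its own block, and that block starts no earlier than
the end of `concatBlocks B k`. -/
theorem concatSeq_tail_le {B : ℕ → List α} (hB : ∀ k, B k ≠ []) (a₀ : α) (β : α → ℕ)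
    (hβ : ∀ k i (hi : i < (B k).length), β (B k)[i] ≤ i) (k j : ℕ) :
    β (concatSeq B a₀ ((concatBlocks B k).length + j)) ≤ j := by
  suffices H : ∀ l, k ≤ l → ∀ j, (concatBlocks B k).length + j < (concatBlocks B l).length →
      β (concatSeq B a₀ ((concatBlocks B k).length + j)) ≤ j by
    refine H (k + j + 1) (by omega) j ?_
    have h1 : ∀ m, (concatBlocks B k).length + m ≤ (concatBlocks B (k + m)).length := by
      intro m
      induction m with
      | zero => simp
      | succ m ih =>
        have := List.length_pos_iff.2 (hB (k + m))
        rw [← add_assoc, ← add_assoc, concatBlocks, List.length_append]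
        omega
    have := h1 (j + 1)
    rw [← add_assoc, ← add_assoc] at this
    omega
  intro l hl
  induction l, hl using Nat.le_induction with
  | base => intro j hj; omega
  | succ l hl ih =>
    intro j hj
    by_cases h : (concatBlocks B k).length + j < (concatBlocks B l).length
    · exact ih j h
    · have hkl := (concatBlocks_prefix B hl).length_le
      simp only [concatBlocks, List.length_append] at hj
      obtain ⟨i, hi⟩ : ∃ i, (concatBlocks B k).length + j = (concatBlocks B l).length + i :=
        ⟨(concatBlocks B k).length + j - (concatBlocks B l).length, by omega⟩
      have hi' : i < (B l).length := by omega
      rw [hi, concatSeq_length_add hB a₀ l hi']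
      have := hβ l i hi'
      omega

/-- Legendre's formula: the 2-adic valuation of `N!` is `N` minus its binary digit sum. -/
theorem sum_padicValNat_two_le (N : ℕ) :
    ∑ k ∈ Finset.range N, (padicValNat 2 (k + 1) + 1) ≤ 2 * N := by
  have h : ∑ k ∈ Finset.range N, padicValNat 2 (k + 1) = padicValNat 2 (Nat.factorial N) := by
    induction N with
    | zero => simp
    | succ N ih =>
      rw [Finset.sum_range_succ, ih, Nat.factorial_succ,
        padicValNat.mul (by omega) (Nat.factorial_ne_zero N), add_comm]
  have h2 := sub_one_mul_padicValNat_factorial (p := 2) N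
  rw [Finset.sum_add_distrib, h]
  simp only [Finset.sum_const, Finset.card_range, smul_eq_mul]
  omega

/-- The word `p`, preceded by a padding so long that the size of each letter is at most its
position. -/
def paddedWord (β : α → ℕ) (a₀ : α) (p : List α) : List α :=
  List.replicate (p.map β).sum a₀ ++ p

open Classical in
/-- An enumeration of all padded words, each occurring infinitely often, such that the `l`-th one
has length and total size at most `l + 1`. -/
noncomputable def slowWord [Encodable α] (β : α → ℕ) (a₀ : α) (l : ℕ) : List α :=
  match (Encodable.decode (Nat.unpair l).1 : Option (List α)) with
  | none => [a₀]
  | some p => if p ≠ [] ∧ p.length + (p.map β).sum ≤ l + 1 then paddedWord β a₀ p else [a₀]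

theorem slowWord_cases [Encodable α] (β : α → ℕ) (a₀ : α) (l : ℕ) :
    slowWord β a₀ l = [a₀] ∨ ∃ p : List α, p ≠ [] ∧ p.length + (p.map β).sum ≤ l + 1 ∧
      slowWord β a₀ l = paddedWord β a₀ p := by
  unfold slowWord
  split
  · exact Or.inl rfl
  · split_ifs with h
    · exact Or.inr ⟨_, h.1, h.2, rfl⟩
    · exact Or.inl rfl

theorem exists_slowWord_eq [Encodable α] (β : α → ℕ) (a₀ : α) {p : List α} (hp : p ≠ []) :
    ∃ l, slowWord β a₀ l = paddedWord β a₀ p := by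
  -- The second component only serves to make the index large enough for the cost bound.
  refine ⟨Nat.pair (Encodable.encode p) (p.length + (p.map β).sum), ?_⟩
  have := Nat.right_le_pair (Encodable.encode p) (p.length + (p.map β).sum)
  simp only [slowWord, Nat.unpair_pair, Encodable.encodek]
  rw [if_pos ⟨hp, by omega⟩]

theorem slowWord_ne_nil [Encodable α] (β : α → ℕ) (a₀ : α) (l : ℕ) : slowWord β a₀ l ≠ [] := by
  rcases slowWord_cases β a₀ l with h | ⟨p, hp, -, h⟩ <;> rw [h]
  · simp
  · simp [paddedWord, hp]

theorem length_slowWord_le [Encodable α] (β : α → ℕ) (a₀ : α) (l : ℕ) :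
    (slowWord β a₀ l).length ≤ l + 1 := by
  rcases slowWord_cases β a₀ l with h | ⟨p, hp, hc, h⟩ <;> rw [h]
  · simp
  · simp only [paddedWord, List.length_append, List.length_replicate]; omega

theorem sum_slowWord_le [Encodable α] {β : α → ℕ} {a₀ : α} (h₀ : β a₀ = 0) (l : ℕ) :
    ((slowWord β a₀ l).map β).sum ≤ l + 1 := by
  rcases slowWord_cases β a₀ l with h | ⟨p, hp, hc, h⟩ <;> rw [h]
  · simp [h₀]
  · simp only [paddedWord, List.map_append, List.map_replicate, List.sum_append, h₀,
      List.sum_replicate, smul_zero]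
    omega

theorem slowWord_getElem_le [Encodable α] {β : α → ℕ} {a₀ : α} (h₀ : β a₀ = 0) (l i : ℕ)
    (hi : i < (slowWord β a₀ l).length) : β (slowWord β a₀ l)[i] ≤ i := by
  rcases slowWord_cases β a₀ l with h | ⟨p, hp, hc, h⟩ <;> simp only [h]
  · simp [h₀]
  · simp only [paddedWord, List.getElem_append]
    split_ifs with h1
    · simp [h₀]
    · simp only [List.length_replicate] at h1
      refine (List.single_le_sum (by simp) _ (List.mem_map_of_mem (List.getElem_mem _))).trans ?_
      omega

/-- There is a sequence of letters of average size at most `2` in which every finite word occurs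
with positive frequency and is followed by letters whose size grows at most linearly. -/
theorem exists_sequence_frequent_words [Encodable α] (β : α → ℕ) (a₀ : α) (h₀ : β a₀ = 0) :
    ∃ σ : ℕ → α, (∀ N, ∑ i ∈ Finset.range N, β (σ i) ≤ 2 * N) ∧
      ∀ p : List α, p ≠ [] → ∃ (C : ℕ) (f : ℕ → ℕ), StrictMono f ∧ (∀ j, f j ≤ C * (j + 1)) ∧
        ∀ j, (∀ k (hk : k < p.length), σ (f j + k) = p[k]) ∧
          ∀ k, p.length ≤ k → β (σ (f j + k)) ≤ k := by
  -- Ruler sequence: the `l`-th word recurs every `2 ^ (l + 1)` blocks, while the average cost per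
  -- block stays at most `2`.
  set B : ℕ → List α := fun k => slowWord β a₀ (padicValNat 2 (k + 1)) with hBdef
  have hB : ∀ k, B k ≠ [] := fun k => slowWord_ne_nil β a₀ _
  have hlen : ∀ k, (concatBlocks B k).length ≤ 2 * k := fun k => by
    rw [length_concatBlocks]
    exact (Finset.sum_le_sum fun i _ => length_slowWord_le β a₀ _).trans (sum_padicValNat_two_le k)
  have hmono : StrictMono fun k => (concatBlocks B k).length := by
    refine strictMono_nat_of_lt_succ fun k => ?_
    have := List.length_pos_iff.2 (hB k)
    simp only [concatBlocks, List.length_append]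
    omega
  refine ⟨concatSeq B a₀, fun N => ?_, fun p hp => ?_⟩
  · exact (sum_concatSeq_le hB a₀ β N).trans
      ((Finset.sum_le_sum fun i _ => sum_slowWord_le h₀ _).trans (sum_padicValNat_two_le N))
  · obtain ⟨l, hl⟩ := exists_slowWord_eq β a₀ hp
    set K := (p.map β).sum
    have hval : ∀ j, padicValNat 2 (2 ^ l * (2 * j + 1) - 1 + 1) = l := fun j => by
      have : 0 < 2 ^ l * (2 * j + 1) := by positivity
      rw [Nat.sub_add_cancel this, padicValNat.mul (by positivity) (by omega),
        padicValNat.prime_pow, padicValNat.eq_zero_of_not_dvd (by omega), add_zero]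
    have hBj : ∀ j, B (2 ^ l * (2 * j + 1) - 1) = paddedWord β a₀ p := fun j => by
      rw [hBdef]; simp only [hval, hl]
    -- The blocks with valuation `l` have indices `2 ^ l * (2 * j + 1) - 1`; adding `K` skips the
    -- padding.
    refine ⟨4 * 2 ^ l + K, fun j => (concatBlocks B (2 ^ l * (2 * j + 1) - 1)).length + K,
      fun i j hij => ?_, fun j => ?_, fun j => ⟨fun k hk => ?_, fun k hk => ?_⟩⟩
    · refine Nat.add_lt_add_right (hmono ?_) K
      have h1 : 0 < 2 ^ l * (2 * i + 1) := by positivity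
      have h2 : 2 ^ l * (2 * i + 1) < 2 ^ l * (2 * j + 1) := by gcongr
      omega
    · have h1 := hlen (2 ^ l * (2 * j + 1) - 1)
      have h2 : 2 * (2 ^ l * (2 * j + 1)) ≤ 4 * 2 ^ l * (j + 1) := by nlinarith [Nat.zero_le (2 ^ l)]
      have h3 : K ≤ K * (j + 1) := Nat.le_mul_of_pos_right _ (by omega)
      have h4 : (4 * 2 ^ l + K) * (j + 1) = 4 * 2 ^ l * (j + 1) + K * (j + 1) := by ring
      simp only
      omega
    · have hlt : K + k < (B (2 ^ l * (2 * j + 1) - 1)).length := by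
        rw [hBj]; simp only [paddedWord, List.length_append, List.length_replicate]; omega
      simp only [add_assoc]
      rw [concatSeq_length_add hB a₀ _ hlt]
      simp only [hBj, paddedWord]
      rw [List.getElem_append_right (by simp [K])]
      simp [K]
    · have hend : (concatBlocks B (2 ^ l * (2 * j + 1) - 1 + 1)).length
          = (concatBlocks B (2 ^ l * (2 * j + 1) - 1)).length + K + p.length := by
        simp only [concatBlocks, hBj, paddedWord, List.length_append, List.length_replicate, K]
        omega
      have := concatSeq_tail_le hB a₀ β (fun k i hi => slowWord_getElem_le h₀ _ i hi)
        (2 ^ l * (2 * j + 1) - 1 + 1) (k - p.length)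
      rw [hend, add_assoc, Nat.add_sub_cancel' hk] at this
      exact this.trans (Nat.sub_le _ _)

end Words

/-! ### Densities and factorial windows -/

section Density

theorem ncard_inter_Icc_div_le_one (A : Set ℕ) (N : ℕ) :
    ((A ∩ Set.Icc 1 N).ncard : ℝ) / N ≤ 1 := by
  refine div_le_one_of_le₀ ?_ (Nat.cast_nonneg N)
  have h := Set.ncard_le_ncard (Set.inter_subset_right (s := A) (t := Set.Icc 1 N))
    (Set.finite_Icc 1 N)
  have h2 : (Set.Icc 1 N).ncard = N := by
    rw [← Finset.coe_Icc, Set.ncard_coe_finset]; simp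
  exact_mod_cast h2 ▸ h

theorem ncard_inter_Icc_div_nonneg (A : Set ℕ) (N : ℕ) :
    0 ≤ ((A ∩ Set.Icc 1 N).ncard : ℝ) / N := by positivity

theorem lowerDensity_pos_of_eventually {A : Set ℕ} {c : ℝ} (hc : 0 < c)
    (h : ∀ᶠ N : ℕ in Filter.atTop, c ≤ ((A ∩ Set.Icc 1 N).ncard : ℝ) / N) :
    0 < lowerDensity A := by
  refine hc.trans_le (Filter.le_liminf_of_le ?_ h)
  exact (Filter.isBoundedUnder_of ⟨1, ncard_inter_Icc_div_le_one A⟩).isCoboundedUnder_ge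

theorem upperDensity_pos_of_frequently {A : Set ℕ} {c : ℝ} (hc : 0 < c)
    (h : ∃ᶠ N : ℕ in Filter.atTop, c ≤ ((A ∩ Set.Icc 1 N).ncard : ℝ) / N) :
    0 < upperDensity A :=
  hc.trans_le (Filter.le_limsup_of_frequently_le h
    (Filter.isBoundedUnder_of ⟨1, ncard_inter_Icc_div_le_one A⟩))

theorem lowerDensity_le_of_frequently {A : Set ℕ} {c : ℝ}
    (h : ∃ᶠ N : ℕ in Filter.atTop, ((A ∩ Set.Icc 1 N).ncard : ℝ) / N ≤ c) :
    lowerDensity A ≤ c :=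
  Filter.liminf_le_of_frequently_le h
    (Filter.isBoundedUnder_of ⟨0, ncard_inter_Icc_div_nonneg A⟩)

/-- The range of a strictly increasing function of linear growth has at least `N / (4 C)` elements
in `(L, N]`, for `N` large with respect to `L`. -/
theorem le_ncard_range_inter_Icc {f : ℕ → ℕ} (hf : StrictMono f) {C : ℕ} (hC : 0 < C)
    (hfC : ∀ j, f j ≤ C * (j + 1)) {A : Set ℕ} {L N : ℕ}
    (hA : ∀ j, L < f j → f j ≤ N → f j ∈ A) (hN : 4 * C * (L + 1) ≤ N) :
    1 / (4 * C : ℝ) ≤ ((A ∩ Set.Icc 1 N).ncard : ℝ) / N := by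
  -- For these indices, `L < j ≤ f j ≤ C * (j + 1) ≤ N`.
  have hsub : ((Finset.Ico (L + 1) (N / C)).image f : Set ℕ) ⊆ A ∩ Set.Icc 1 N := by
    intro n hn
    simp only [Finset.coe_image, Set.mem_image, Finset.coe_Ico, Set.mem_Ico] at hn
    obtain ⟨j, ⟨hj1, hj2⟩, rfl⟩ := hn
    have h1 := hf.le_apply (x := j)
    have h2 : f j ≤ N := (hfC j).trans ((Nat.mul_le_mul_left C hj2).trans (Nat.mul_div_le N C))
    exact ⟨hA j (by omega) h2, by omega, h2⟩
  have hcard := Set.ncard_le_ncard hsub ((Set.finite_Icc 1 N).inter_of_right A)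
  rw [Set.ncard_coe_finset, Finset.card_image_of_injective _ hf.injective, Nat.card_Ico] at hcard
  have hdiv : N < C * (N / C + 1) := by
    rw [mul_add, mul_one]; exact Nat.lt_mul_div_succ N hC
  have hge : N / C ≥ 4 * (L + 1) := by
    rw [ge_iff_le, Nat.le_div_iff_mul_le hC]; linarith
  have hfin : N ≤ 4 * C * (A ∩ Set.Icc 1 N).ncard := by
    have : N / C + 1 ≤ 4 * (A ∩ Set.Icc 1 N).ncard := by omega
    nlinarith
  have hN0 : 0 < N := lt_of_lt_of_le (by positivity) hN
  rw [div_le_div_iff₀ (by positivity) (by positivity)]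
  have : (N : ℝ) ≤ 4 * C * (A ∩ Set.Icc 1 N).ncard := by exact_mod_cast hfin
  linarith

theorem lowerDensity_pos_of_strictMono {f : ℕ → ℕ} (hf : StrictMono f) {C : ℕ}
    (hfC : ∀ j, f j ≤ C * (j + 1)) {A : Set ℕ} (hA : ∀ j, f j ∈ A) : 0 < lowerDensity A := by
  have hC : 0 < C := by
    by_contra h
    have h1 := hfC 1
    have h2 := hf.le_apply (x := 1)
    simp only [show C = 0 by omega, zero_mul] at h1
    omega
  refine lowerDensity_pos_of_eventually (c := 1 / (4 * C : ℝ)) (by positivity) ?_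
  filter_upwards [Filter.eventually_ge_atTop (4 * C * (0 + 1))] with N hN
  exact le_ncard_range_inter_Icc hf hC hfC (fun j _ _ => hA j) hN

/-- The union of the intervals `[(2j+2)!, (2j+3)!)`. -/
def factorialWindows : Set ℕ :=
  {i | ∃ j, Nat.factorial (2 * j + 2) ≤ i ∧ i < Nat.factorial (2 * j + 3)}

theorem zero_notMem_factorialWindows : 0 ∉ factorialWindows := by
  rintro ⟨j, h, -⟩
  have := Nat.factorial_pos (2 * j + 2)
  omega

theorem notMem_factorialWindows {i j : ℕ} (h1 : Nat.factorial (2 * j + 3) ≤ i)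
    (h2 : i < Nat.factorial (2 * j + 4)) : i ∉ factorialWindows := by
  rintro ⟨k, hk1, hk2⟩
  rcases le_or_gt k j with h | h
  · have := Nat.factorial_le (show 2 * k + 3 ≤ 2 * j + 3 by omega)
    omega
  · have := Nat.factorial_le (show 2 * j + 4 ≤ 2 * k + 2 by omega)
    omega

/-- Just before the end of a late window, the times preceding that window are a negligible
proportion. Stopping `m` short of the end keeps `f j, …, f j + m - 1` inside. -/
theorem upperDensity_pos_of_strictMono {f : ℕ → ℕ} (hf : StrictMono f) {C : ℕ}
    (hfC : ∀ j, f j ≤ C * (j + 1)) (m : ℕ) {A : Set ℕ}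
    (hA : ∀ j, (∀ k < m, f j + k ∈ factorialWindows) → f j ∈ A) : 0 < upperDensity A := by
  have hC : 0 < C := by
    by_contra h
    have h1 := hfC 1
    have h2 := hf.le_apply (x := 1)
    simp only [show C = 0 by omega, zero_mul] at h1
    omega
  refine upperDensity_pos_of_frequently (c := 1 / (4 * C : ℝ)) (by positivity) ?_
  rw [Filter.frequently_atTop]
  intro N₀
  set j := N₀ + 8 * C + m with hj
  have hpos : 2 * j + 2 ≤ Nat.factorial (2 * j + 2) := Nat.self_le_factorial _
  have hfac : Nat.factorial (2 * j + 3) = (2 * j + 3) * Nat.factorial (2 * j + 2) := by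
    rw [← Nat.factorial_succ]
  have h8 : (8 * C + 1) * Nat.factorial (2 * j + 2) ≤ Nat.factorial (2 * j + 3) := by
    rw [hfac]; exact Nat.mul_le_mul_right _ (by omega)
  have h9 : 8 * C * Nat.factorial (2 * j + 2) ≤ Nat.factorial (2 * j + 3) - m := by
    rw [add_mul] at h8; omega
  refine ⟨Nat.factorial (2 * j + 3) - m, ?_, ?_⟩
  · have : Nat.factorial (2 * j + 2) ≤ 8 * C * Nat.factorial (2 * j + 2) :=
      Nat.le_mul_of_pos_left _ (by omega)
    show N₀ ≤ _
    omega
  · refine le_ncard_range_inter_Icc hf hC hfC (L := Nat.factorial (2 * j + 2))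
      (fun i hi1 hi2 => hA i fun k hk => ⟨j, by omega, by omega⟩) ?_
    nlinarith

/-- Up to `(2j+4)! - 1`, the end of a gap, `A` has fewer than `(2j+3)!` positive elements, a
proportion of at most `1 / (j + 1)`. -/
theorem lowerDensity_nonpos_of_subset {A : Set ℕ} (hA : A ⊆ factorialWindows) :
    lowerDensity A ≤ 0 := by
  refine le_of_forall_pos_le_add fun ε hε => ?_
  rw [zero_add]
  refine lowerDensity_le_of_frequently ?_
  rw [Filter.frequently_atTop]
  intro N₀
  obtain ⟨q, hq⟩ := exists_nat_gt (1 / ε)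
  set j := N₀ + q with hj
  have hfac : Nat.factorial (2 * j + 4) = (2 * j + 4) * Nat.factorial (2 * j + 3) := by
    rw [← Nat.factorial_succ]
  have hpos : 2 * j + 3 ≤ Nat.factorial (2 * j + 3) := Nat.self_le_factorial _
  have hN : (j + 1) * Nat.factorial (2 * j + 3) ≤ Nat.factorial (2 * j + 4) - 1 := by
    have : (j + 2) * Nat.factorial (2 * j + 3) ≤ (2 * j + 4) * Nat.factorial (2 * j + 3) :=
      Nat.mul_le_mul_right _ (by omega)
    rw [hfac]
    have h2 : (j + 2) * Nat.factorial (2 * j + 3)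
      = (j + 1) * Nat.factorial (2 * j + 3) + Nat.factorial (2 * j + 3) := by ring
    omega
  have hNpos : Nat.factorial (2 * j + 3) ≤ (j + 1) * Nat.factorial (2 * j + 3) :=
    Nat.le_mul_of_pos_left _ (by omega)
  refine ⟨Nat.factorial (2 * j + 4) - 1, by show N₀ ≤ _; omega, ?_⟩
  have hsub : A ∩ Set.Icc 1 (Nat.factorial (2 * j + 4) - 1)
      ⊆ (Finset.range (Nat.factorial (2 * j + 3)) : Set ℕ) := by
    rintro n ⟨hn, -, hn2⟩
    rw [Finset.coe_range, Set.mem_Iio]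
    by_contra h
    exact notMem_factorialWindows (not_lt.1 h) (by omega) (hA hn)
  have hcard := Set.ncard_le_ncard hsub (Finset.finite_toSet _)
  rw [Set.ncard_coe_finset, Finset.card_range] at hcard
  have hN0 : (0 : ℝ) < ((Nat.factorial (2 * j + 4) - 1 : ℕ) : ℝ) := by
    exact_mod_cast (show 0 < Nat.factorial (2 * j + 4) - 1 by omega)
  rw [div_le_iff₀ hN0]
  have h1 : (1 : ℝ) ≤ ε * (j + 1) := by
    rw [div_lt_iff₀ hε] at hq
    have : (q : ℝ) ≤ j := by exact_mod_cast (show q ≤ j by omega)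
    nlinarith
  have h2 : ((j : ℝ) + 1) * (Nat.factorial (2 * j + 3) : ℝ)
      ≤ ((Nat.factorial (2 * j + 4) - 1 : ℕ) : ℝ) := by exact_mod_cast hN
  have h3 : ((A ∩ Set.Icc 1 (Nat.factorial (2 * j + 4) - 1)).ncard : ℝ)
      ≤ (Nat.factorial (2 * j + 3) : ℝ) := by exact_mod_cast hcard
  calc _ ≤ 1 * (Nat.factorial (2 * j + 3) : ℝ) := by rw [one_mul]; exact h3
    _ ≤ ε * (j + 1) * (Nat.factorial (2 * j + 3) : ℝ) := by gcongr
    _ = ε * ((j + 1) * (Nat.factorial (2 * j + 3) : ℝ)) := by ring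
    _ ≤ _ := by gcongr

end Density

/-! ### Iterates of weighted shifts and construction of weights -/

section ShiftDynamics

theorem sum_single_apply {𝕜 : Type*} [RCLike 𝕜] {p : ℝ≥0∞} (y : ℕ → 𝕜) (m j : ℕ) :
    (∑ i ∈ Finset.range m, lp.single (E := fun _ : ℕ => 𝕜) p i (y i)) j
      = if j < m then y j else 0 := by
  rw [lp.coeFn_sum, Finset.sum_apply]
  by_cases h : j < m
  · rw [if_pos h, Finset.sum_eq_single_of_mem j (Finset.mem_range.2 h)]
    · simp
    · intro b _ hb
      simp [hb.symm]
  · rw [if_neg h]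
    refine Finset.sum_eq_zero fun b hb => ?_
    have : j ≠ b := by rw [Finset.mem_range] at hb; omega
    simp [this]

variable {𝕜 : Type*} [RCLike 𝕜] {p : ℝ≥0∞} [Fact (1 ≤ p)]

theorem weightedShift_pow_apply (hp : p ≠ ∞) {v : lp (fun _ : ℕ => 𝕜) ∞} {V : ℕ → 𝕜}
    (hV : ∀ i, V i ≠ 0) (hv : ∀ i, v (i + 1) = V (i + 1) / V i) (n : ℕ)
    (x : lp (fun _ : ℕ => 𝕜) p) (j : ℕ) :
    (weightedShift p hp v ^ n) x j = V (n + j) / V j * x (n + j) := by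
  induction n generalizing j with
  | zero => simp [div_self (hV j)]
  | succ n ih =>
    rw [pow_succ', mul_apply_eq_comp, weightedShift_apply, ih, hv, ← mul_assoc,
      show n + (j + 1) = n + 1 + j by ring]
    congr 1
    have := hV j
    have := hV (j + 1)
    field_simp

/-- The triangle inequality over the basis expansion bounds the `ℓ^p` norm by the `ℓ¹` norm, so one
estimate serves all `p`. -/
theorem lp_norm_le_of_hasSum (hp : p ≠ ∞) (z : lp (fun _ : ℕ => 𝕜) p) {G : ℕ → ℝ} {S : ℝ}
    (hz : ∀ i, ‖z i‖ ≤ G i) (hG : HasSum G S) : ‖z‖ ≤ S := by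
  have hp0 : 0 < p := zero_lt_one.trans_le (Fact.out : 1 ≤ p)
  have h := (lp.hasSum_single hp z).tsum_eq
  rw [← h]
  refine tsum_of_norm_bounded hG fun i => ?_
  rw [lp.norm_single hp0]
  exact hz i

theorem memℓp_of_le_geometric {x : ℕ → 𝕜} {c : ℝ}
    (hx : ∀ i, ‖x i‖ ≤ c * (1 / 4) ^ i) : Memℓp x p := by
  have hG : Summable fun i : ℕ => c * (1 / 4 : ℝ) ^ i :=
    (summable_geometric_of_lt_one (by norm_num) (by norm_num)).mul_left c
  have h1 : Memℓp x 1 := by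
    refine memℓp_gen ?_
    simp only [ENNReal.toReal_one, Real.rpow_one]
    exact Summable.of_nonneg_of_le (fun i => norm_nonneg _) hx hG
  exact h1.of_exponent_ge Fact.out

theorem exists_trunc_dist_lt (hp : p ≠ ∞) (y : lp (fun _ : ℕ => 𝕜) p) {ε : ℝ} (hε : 0 < ε) :
    ∃ m₀, ∀ m ≥ m₀, ‖(∑ i ∈ Finset.range m, lp.single p i (y i)) - y‖ < ε := by
  have h := (lp.hasSum_single hp y).tendsto_sum_nat
  obtain ⟨m₀, h⟩ := Metric.tendsto_atTop.1 h ε hε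
  exact ⟨m₀, fun m hm => by rw [← dist_eq_norm]; exact h m hm⟩

/-- If the sequence `s = V x` agrees up to `η` with `V y` on `[n, n + m)` and grows slowly
afterwards, then the `n`-th iterate of `x` is close to `y`. -/
theorem norm_weightedShift_pow_sub_lt (hp : p ≠ ∞) {v : lp (fun _ : ℕ => 𝕜) ∞} {V : ℕ → 𝕜}
    (hV : ∀ i, 16 ^ i / 16 ≤ ‖V i‖) (hv : ∀ i, v (i + 1) = V (i + 1) / V i)
    (x y : lp (fun _ : ℕ => 𝕜) p) {ε : ℝ} {m n : ℕ}
    (hm : ‖(∑ i ∈ Finset.range m, lp.single p i (y i)) - y‖ < ε / 2)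
    (hm2 : 128 * (1 / 2 : ℝ) ^ m ≤ ε)
    (h1 : ∀ k < m, ‖V (n + k) * x (n + k) - V k * y k‖ ≤ ε / 128)
    (h2 : ∀ k, m ≤ k → ‖V (n + k) * x (n + k)‖ ≤ 2 ^ k) :
    ‖(weightedShift p hp v ^ n) x - y‖ < ε := by
  have hVpos : ∀ i, 0 < ‖V i‖ := fun i => lt_of_lt_of_le (by positivity) (hV i)
  have hV0 : ∀ i, V i ≠ 0 := fun i => norm_pos_iff.1 (hVpos i)
  have hε : 0 < ε := lt_of_lt_of_le (by positivity) hm2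
  have key : ‖(weightedShift p hp v ^ n) x - ∑ i ∈ Finset.range m, lp.single p i (y i)‖
      ≤ ε / 4 * 2 := by
    -- Dividing by `V j`, of norm at least `16 ^ j / 16`, turns both the errors `ε / 128` and the
    -- tail terms `2 ^ j` into geometrically small coordinates.
    refine lp_norm_le_of_hasSum hp _ (G := fun j => ε / 4 * (1 / 2) ^ j) (fun j => ?_)
      (hasSum_geometric_two.mul_left _)
    rw [lp.coeFn_sub, Pi.sub_apply, sum_single_apply, weightedShift_pow_apply hp hV0 hv]
    have h16 : (16 : ℝ) ^ j = 2 ^ j * (2 ^ j * 4 ^ j) := by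
      rw [← mul_pow, ← mul_pow]; norm_num
    have h4 : (1 : ℝ) ≤ 4 ^ j := one_le_pow₀ (by norm_num)
    have h2' : (1 : ℝ) ≤ 2 ^ j := one_le_pow₀ (by norm_num)
    have hhalf : (1 / 2 : ℝ) ^ j * 2 ^ j = 1 := by rw [← mul_pow]; norm_num
    split_ifs with hj
    · have : V (n + j) / V j * x (n + j) - y j
          = (V (n + j) * x (n + j) - V j * y j) / V j := by
        have := hV0 j
        field_simp
      rw [this, norm_div, div_le_iff₀ (hVpos j)]
      refine (h1 j hj).trans ?_
      calc ε / 128 ≤ ε / 64 * ((1 / 2) ^ j * 2 ^ j * (2 ^ j * 4 ^ j)) := by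
            rw [hhalf]
            have : (1 : ℝ) ≤ 2 ^ j * 4 ^ j := one_le_mul_of_one_le_of_one_le h2' h4
            nlinarith
        _ = ε / 4 * (1 / 2) ^ j * (16 ^ j / 16) := by rw [h16]; ring
        _ ≤ _ := by gcongr; exact hV j
    · rw [sub_zero, show V (n + j) / V j * x (n + j) = V (n + j) * x (n + j) / V j by ring,
        norm_div, div_le_iff₀ (hVpos j)]
      refine (h2 j (not_lt.1 hj)).trans ?_
      have hjm : (1 / 2 : ℝ) ^ j ≤ (1 / 2) ^ m :=
        pow_le_pow_of_le_one (by norm_num) (by norm_num) (not_lt.1 hj)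
      have hε2 : 64 * (1 / 2 : ℝ) ^ j ≤ ε := by
        have : (0 : ℝ) ≤ (1 / 2) ^ m := by positivity
        linarith
      calc (2 : ℝ) ^ j ≤ 4 ^ j := pow_le_pow_left₀ (by norm_num) (by norm_num) j
        _ = ((1 / 2) ^ j * 2 ^ j) * ((1 / 2) ^ j * 2 ^ j) * 4 ^ j := by rw [hhalf]; ring
        _ = 64 * (1 / 2) ^ j / 4 * (1 / 2) ^ j * (16 ^ j / 16) := by rw [h16]; ring
        _ ≤ ε / 4 * (1 / 2) ^ j * (16 ^ j / 16) := by gcongr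
        _ ≤ _ := by gcongr; exact hV j
  calc ‖(weightedShift p hp v ^ n) x - y‖
      ≤ ‖(weightedShift p hp v ^ n) x - ∑ i ∈ Finset.range m, lp.single p i (y i)‖
        + ‖(∑ i ∈ Finset.range m, lp.single p i (y i)) - y‖ := norm_sub_le_norm_sub_add_norm_sub ..
    _ < ε := by linarith

theorem directSumOp_pow_apply {X : Type*} [AddCommGroup X] [Module 𝕜 X] [TopologicalSpace X]
    {N : ℕ} (T : Fin N → X →L[𝕜] X) (n : ℕ) (u : Fin N → X) (i : Fin N) :
    (directSumOp T ^ n) u i = (T i ^ n) (u i) := by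
  induction n with
  | zero => simp
  | succ n ih =>
    rw [pow_succ', pow_succ', mul_apply_eq_comp, mul_apply_eq_comp, ← ih]
    rfl

/-- Weights whose partial products are `s i * 256 ^ i / 2 ^ (∑ a < i, (b a + b (a + 1)))`. -/
theorem exists_weight {s : ℕ → 𝕜} {b : ℕ → ℕ} (hs1 : ∀ i, ‖s i‖ ≤ 2 ^ b i)
    (hs2 : ∀ i, (2 ^ b i)⁻¹ ≤ ‖s i‖) {V : ℕ → 𝕜}
    (hV : ∀ i, V i = s i * (256 ^ i / 2 ^ (∑ a ∈ Finset.range i, (b a + b (a + 1))))) :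
    ∃ v : lp (fun _ : ℕ => 𝕜) ∞, ∀ i, v (i + 1) = V (i + 1) / V i := by
  have hmem : Memℓp (fun i => V i / V (i - 1)) ∞ := by
    refine memℓp_infty ⟨256, ?_⟩
    rintro _ ⟨i, rfl⟩
    cases i with
    | zero =>
      -- Truncated subtraction makes the irrelevant entry at `0` equal to `V 0 / V 0`.
      refine (norm_div _ _).trans_le ((div_self_le_one _).trans (by norm_num))
    | succ i =>
      have hsi : s i ≠ 0 := norm_pos_iff.1 (lt_of_lt_of_le (by positivity) (hs2 i))
      have hsi' : 0 < ‖s i‖ := norm_pos_iff.2 hsi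
      -- The factor `2 ^ (b i + b (i + 1))` absorbs the worst jump of `s`, so every weight has norm
      -- at most `256`.
      have : V (i + 1) / V i = s (i + 1) / s i * (256 / 2 ^ (b i + b (i + 1))) := by
        rw [hV, hV, Finset.sum_range_succ, pow_add (2 : 𝕜), pow_succ (256 : 𝕜)]
        have h2 : ∀ e : ℕ, (2 : 𝕜) ^ e ≠ 0 := fun e => pow_ne_zero _ two_ne_zero
        have h3 : ∀ e : ℕ, (256 : 𝕜) ^ e ≠ 0 := fun e => pow_ne_zero _ (by norm_num)
        have := h2 (b i + b (i + 1))
        have := h2 (∑ a ∈ Finset.range i, (b a + b (a + 1)))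
        have := h3 i
        field_simp
      simp only [Nat.add_sub_cancel]
      rw [this, norm_mul, norm_div, norm_div, norm_pow, RCLike.norm_ofNat, RCLike.norm_ofNat,
        pow_add]
      have hb := hs2 i
      rw [inv_le_iff_one_le_mul₀ (by positivity)] at hb
      rw [div_mul_div_comm, div_le_iff₀ (by positivity)]
      calc ‖s (i + 1)‖ * 256 ≤ 2 ^ b (i + 1) * 256 * (‖s i‖ * 2 ^ b i) := by
            have := hs1 (i + 1)
            have h5 : (0 : ℝ) ≤ 2 ^ b (i + 1) * 256 := by positivity
            nlinarith
        _ = _ := by ring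
  exact ⟨⟨_, hmem⟩, fun i => by simp⟩

/-- Average size at most `2` bounds the accumulated exponent of `2` by `4 * (i + 1)`, so the loss
against `256 ^ i` is at most `16 ^ (i + 1)`. -/
theorem le_norm_partial_product {s : ℕ → 𝕜} {b : ℕ → ℕ}
    (hs2 : ∀ i, (2 ^ b i)⁻¹ ≤ ‖s i‖) (hb : ∀ N, ∑ i ∈ Finset.range N, b i ≤ 2 * N) {V : ℕ → 𝕜}
    (hV : ∀ i, V i = s i * (256 ^ i / 2 ^ (∑ a ∈ Finset.range i, (b a + b (a + 1))))) (i : ℕ) :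
    16 ^ i / 16 ≤ ‖V i‖ := by
  rw [hV, norm_mul, norm_div, norm_pow, norm_pow, RCLike.norm_ofNat, RCLike.norm_ofNat]
  have hexp : b i + ∑ a ∈ Finset.range i, (b a + b (a + 1)) ≤ 4 * (i + 1) := by
    have h1 := hb (i + 1)
    have h2 := Finset.sum_range_succ' b i
    rw [Finset.sum_range_succ] at h1 h2
    rw [Finset.sum_add_distrib]
    omega
  have h2 : (2 : ℝ) ^ (b i + ∑ a ∈ Finset.range i, (b a + b (a + 1))) ≤ 16 * 16 ^ i := by
    calc _ ≤ (2 : ℝ) ^ (4 * (i + 1)) := pow_le_pow_right₀ (by norm_num) hexp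
      _ = _ := by rw [pow_mul, pow_succ]; norm_num; ring
  calc (16 : ℝ) ^ i / 16 = 256 ^ i / (16 * 16 ^ i) := by
        rw [show (256 : ℝ) = 16 * 16 by norm_num, mul_pow]
        field_simp
    _ ≤ 256 ^ i / 2 ^ (b i + ∑ a ∈ Finset.range i, (b a + b (a + 1))) := by gcongr
    _ = (2 ^ b i)⁻¹ * (256 ^ i / 2 ^ (∑ a ∈ Finset.range i, (b a + b (a + 1)))) := by
        rw [pow_add]; field_simp
    _ ≤ _ := by gcongr; exact hs2 i

theorem memℓp_div_partial_product {s V : ℕ → 𝕜} {b : ℕ → ℕ}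
    (hs1 : ∀ i, ‖s i‖ ≤ 2 ^ b i) (hb : ∀ N, ∑ i ∈ Finset.range N, b i ≤ 2 * N)
    (hV : ∀ i, 16 ^ i / 16 ≤ ‖V i‖) : Memℓp (fun i => s i / V i) p := by
  refine memℓp_of_le_geometric (c := 64) fun i => ?_
  have h1 : b i ≤ 2 * (i + 1) := by
    have := hb (i + 1)
    rw [Finset.sum_range_succ] at this
    omega
  have h2 : ‖s i‖ ≤ 4 * 4 ^ i := by
    calc _ ≤ (2 : ℝ) ^ b i := hs1 i
      _ ≤ 2 ^ (2 * (i + 1)) := pow_le_pow_right₀ (by norm_num) h1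
      _ = _ := by rw [pow_mul, pow_succ]; norm_num; ring
  rw [norm_div, div_le_iff₀ (lt_of_lt_of_le (by positivity) (hV i))]
  calc ‖s i‖ ≤ 4 * 4 ^ i := h2
    _ = 64 * (1 / 4) ^ i * (16 ^ i / 16) := by
        rw [show (16 : ℝ) ^ i = 4 ^ i * 4 ^ i by rw [← mul_pow]; norm_num]
        have : (1 / 4 : ℝ) ^ i * 4 ^ i = 1 := by rw [← mul_pow]; norm_num
        linear_combination (-4 * 4 ^ i) * this
    _ ≤ _ := by gcongr; exact hV i

end ShiftDynamics

/-! ### A dense alphabet of nonzero scalars -/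

section Alphabet

theorem exists_two_pow_bounds {c : ℝ} (hc : 0 < c) : ∃ b : ℕ, c ≤ 2 ^ b ∧ (2 ^ b)⁻¹ ≤ c := by
  obtain ⟨b, hb⟩ := pow_unbounded_of_one_lt (max c c⁻¹) (one_lt_two (α := ℝ))
  refine ⟨b, (le_max_left _ _).trans hb.le, ?_⟩
  rw [inv_le_comm₀ (by positivity) hc]
  exact (le_max_right _ _).trans hb.le

/-- A countable dense alphabet of nonzero scalars: the letter `a` stands for the scalar `c a`, of
size `β a`. -/
structure IsDenseAlphabet {𝕜 : Type*} [RCLike 𝕜] (c : Option ℕ → 𝕜) (β : Option ℕ → ℕ) : Prop where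
  size_none : β none = 0
  norm_le : ∀ a, ‖c a‖ ≤ 2 ^ β a
  le_norm : ∀ a, (2 ^ β a)⁻¹ ≤ ‖c a‖
  dense : ∀ (z : 𝕜) {ε : ℝ}, 0 < ε → ∃ a, ‖c a - z‖ ≤ ε

theorem exists_isDenseAlphabet (𝕜 : Type*) [RCLike 𝕜] :
    ∃ (c : Option ℕ → 𝕜) (β : Option ℕ → ℕ), IsDenseAlphabet c β := by
  have : Nonempty {z : 𝕜 // z ≠ 0} := ⟨⟨1, one_ne_zero⟩⟩
  obtain ⟨e, he⟩ := TopologicalSpace.exists_dense_seq {z : 𝕜 // z ≠ 0}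
  choose b hb1 hb2 using fun i => exists_two_pow_bounds (norm_pos_iff.2 (e i).2)
  -- The letter `none` stands for `1`: it has size zero, as padding requires.
  refine ⟨fun a => a.elim 1 fun i => (e i : 𝕜), fun a => a.elim 0 b, rfl, ?_, ?_, ?_⟩
  · rintro (_ | i)
    · simp
    · exact hb1 i
  · rintro (_ | i)
    · simp
    · exact hb2 i
  · intro z ε hε
    have hd : Dense {z : 𝕜 | z ≠ 0} := dense_compl_singleton 0
    obtain ⟨z', hz', hz'0⟩ := Metric.dense_iff.1 hd z (ε / 2) (by positivity)
    obtain ⟨i, hi⟩ := Metric.denseRange_iff.1 he ⟨z', hz'0⟩ (ε / 2) (by positivity)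
    refine ⟨some i, ?_⟩
    have h1 : ‖z' - z‖ < ε / 2 := by rw [← dist_eq_norm]; exact hz'
    have h2 : ‖(e i : 𝕜) - z'‖ < ε / 2 := by
      rw [← dist_eq_norm, dist_comm]; exact hi
    have := norm_sub_le_norm_sub_add_norm_sub (e i : 𝕜) z' z
    show ‖(e i : 𝕜) - z‖ ≤ ε
    linarith

/-- The size of a pair of letters. -/
def pairSize (β : Option ℕ → ℕ) (a : Option ℕ × Option ℕ) : ℕ := β a.1 + β a.2

/-- Every finite word of pairs of letters occurs frequently in `σ`, followed by letters of linearly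
growing size. -/
def HasFrequentWords (β : Option ℕ → ℕ) (σ : ℕ → Option ℕ × Option ℕ) : Prop :=
  ∀ p : List (Option ℕ × Option ℕ), p ≠ [] → ∃ (C : ℕ) (f : ℕ → ℕ), StrictMono f ∧
    (∀ j, f j ≤ C * (j + 1)) ∧ ∀ j, (∀ k (hk : k < p.length), σ (f j + k) = p[k]) ∧
      ∀ k, p.length ≤ k → pairSize β (σ (f j + k)) ≤ k

variable {𝕜 : Type*} [RCLike 𝕜] {c : Option ℕ → 𝕜} {β : Option ℕ → ℕ}

theorem IsDenseAlphabet.norm_fst_le (h : IsDenseAlphabet c β) (a : Option ℕ × Option ℕ) :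
    ‖c a.1‖ ≤ 2 ^ pairSize β a :=
  (h.norm_le _).trans (pow_le_pow_right₀ one_le_two (Nat.le_add_right _ _))

theorem IsDenseAlphabet.norm_snd_le (h : IsDenseAlphabet c β) (a : Option ℕ × Option ℕ) :
    ‖c a.2‖ ≤ 2 ^ pairSize β a :=
  (h.norm_le _).trans (pow_le_pow_right₀ one_le_two (Nat.le_add_left _ _))

theorem IsDenseAlphabet.le_norm_fst (h : IsDenseAlphabet c β) (a : Option ℕ × Option ℕ) :
    (2 ^ pairSize β a)⁻¹ ≤ ‖c a.1‖ :=
  (inv_anti₀ (by positivity) (pow_le_pow_right₀ one_le_two (Nat.le_add_right _ _))).trans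
    (h.le_norm _)

theorem IsDenseAlphabet.le_norm_snd (h : IsDenseAlphabet c β) (a : Option ℕ × Option ℕ) :
    (2 ^ pairSize β a)⁻¹ ≤ ‖c a.2‖ :=
  (inv_anti₀ (by positivity) (pow_le_pow_right₀ one_le_two (Nat.le_add_left _ _))).trans
    (h.le_norm _)

/-- Any pair of sequences of scalars is approximated on a given initial segment, with positive
frequency. -/
theorem HasFrequentWords.exists_approx {σ : ℕ → Option ℕ × Option ℕ}
    (hσ : HasFrequentWords β σ) (hc : IsDenseAlphabet c β) (Y Z : ℕ → 𝕜) {m : ℕ} (hm : 0 < m)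
    {ε : ℝ} (hε : 0 < ε) :
    ∃ (C : ℕ) (f : ℕ → ℕ), StrictMono f ∧ (∀ j, f j ≤ C * (j + 1)) ∧
      ∀ j, (∀ k < m, ‖c (σ (f j + k)).1 - Y k‖ ≤ ε ∧ ‖c (σ (f j + k)).2 - Z k‖ ≤ ε) ∧
        ∀ k, m ≤ k → pairSize β (σ (f j + k)) ≤ k := by
  choose a ha using fun k => hc.dense (Y k) hε
  choose a' ha' using fun k => hc.dense (Z k) hε
  have hlen : ((List.range m).map fun k => (a k, a' k)).length = m := by simp
  obtain ⟨C, f, hf, hfC, h⟩ := hσ ((List.range m).map fun k => (a k, a' k))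
    (List.length_pos_iff.1 (hlen.symm ▸ hm))
  refine ⟨C, f, hf, hfC, fun j => ⟨fun k hk => ?_, fun k hk => (h j).2 k (by rwa [hlen])⟩⟩
  rw [(h j).1 k (by rwa [hlen])]
  simp only [List.getElem_map, List.getElem_range]
  exact ⟨ha k, ha' k⟩

end Alphabet

/-! ### Frequent and disjoint hypercyclicity of the shifts -/

section DisjointShifts

variable {𝕜 : Type*} [RCLike 𝕜] {p : ℝ≥0∞} [Fact (1 ≤ p)] {c : Option ℕ → 𝕜} {β : Option ℕ → ℕ}
  {σ : ℕ → Option ℕ × Option ℕ}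

theorem exists_pos_pow_le (m₀ : ℕ) {ε : ℝ} (hε : 0 < ε) :
    ∃ m ≥ m₀, 0 < m ∧ 128 * (1 / 2 : ℝ) ^ m ≤ ε := by
  obtain ⟨q, hq⟩ := exists_pow_lt_of_lt_one (show (0 : ℝ) < ε / 128 by positivity)
    (show (1 / 2 : ℝ) < 1 by norm_num)
  refine ⟨max (q + 1) m₀, le_max_right _ _, by omega, ?_⟩
  have := pow_le_pow_of_le_one (show (0 : ℝ) ≤ 1 / 2 by norm_num) (by norm_num)
    (show q ≤ max (q + 1) m₀ by omega)
  linarith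

theorem isFrequentlyHypercyclic_weightedShift (hp : p ≠ ∞) (hc : IsDenseAlphabet c β)
    (hσ : HasFrequentWords β σ)
    (hσ' : ∀ N, ∑ i ∈ Finset.range N, pairSize β (σ i) ≤ 2 * N)
    {v : lp (fun _ : ℕ => 𝕜) ∞} {V : ℕ → 𝕜}
    (hV : ∀ i, 16 ^ i / 16 ≤ ‖V i‖) (hv : ∀ i, v (i + 1) = V (i + 1) / V i) :
    IsFrequentlyHypercyclic (weightedShift p hp v) := by
  have hV0 : ∀ i, V i ≠ 0 := fun i => norm_pos_iff.1 (lt_of_lt_of_le (by positivity) (hV i))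
  refine ⟨⟨fun i => c (σ i).1 / V i,
    memℓp_div_partial_product (fun i => hc.norm_fst_le (σ i)) hσ' hV⟩, fun U hU hUne => ?_⟩
  obtain ⟨y, hy⟩ := hUne
  obtain ⟨ε, hε, hball⟩ := Metric.isOpen_iff.1 hU y hy
  obtain ⟨m₀, hm₀⟩ := exists_trunc_dist_lt hp y (half_pos hε)
  obtain ⟨m, hmm₀, hm, hm2⟩ := exists_pos_pow_le m₀ hε
  -- Only the first component matters here; the second target is arbitrary.
  obtain ⟨C, f, hf, hfC, h⟩ := hσ.exists_approx hc (fun k => V k * y k) (fun k => V k * y k) hm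
    (show (0 : ℝ) < ε / 128 by positivity)
  refine lowerDensity_pos_of_strictMono hf hfC fun j => hball ?_
  rw [Metric.mem_ball, dist_eq_norm]
  refine norm_weightedShift_pow_sub_lt hp hV hv _ y (hm₀ m hmm₀) hm2 (fun k hk => ?_)
    fun k hk => ?_
  · have := ((h j).1 k hk).1
    simpa only [mul_div_cancel₀ _ (hV0 _)] using this
  · have := (hc.norm_fst_le _).trans (pow_le_pow_right₀ one_le_two ((h j).2 k hk))
    simpa only [mul_div_cancel₀ _ (hV0 _)] using this

theorem areDisjointUpperFrequentlyHypercyclic_weightedShift (hp : p ≠ ∞)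
    (hc : IsDenseAlphabet c β) (hσ : HasFrequentWords β σ) {τ : ℕ → Option ℕ × Option ℕ}
    (hτ₁ : ∀ i ∈ factorialWindows, τ i = σ i)
    (hτ₂ : ∀ i, pairSize β (τ i) ≤ pairSize β (σ i))
    {v w : lp (fun _ : ℕ => 𝕜) ∞} {V W : ℕ → 𝕜}
    (hV : ∀ i, 16 ^ i / 16 ≤ ‖V i‖) (hv : ∀ i, v (i + 1) = V (i + 1) / V i)
    (hW : ∀ i, 16 ^ i / 16 ≤ ‖W i‖) (hw : ∀ i, w (i + 1) = W (i + 1) / W i)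
    (x : lp (fun _ : ℕ => 𝕜) p) (hxV : ∀ i, V i * x i = c (τ i).1)
    (hxW : ∀ i, W i * x i = c (τ i).2) :
    AreDisjointUpperFrequentlyHypercyclic ![weightedShift p hp v, weightedShift p hp w] := by
  refine ⟨x, fun U hU hUne => ?_⟩
  obtain ⟨y, hy⟩ := hUne
  obtain ⟨ε, hε, hball⟩ := Metric.isOpen_iff.1 hU y hy
  obtain ⟨m₁, hm₁⟩ := exists_trunc_dist_lt hp (y 0) (half_pos hε)
  obtain ⟨m₂, hm₂⟩ := exists_trunc_dist_lt hp (y 1) (half_pos hε)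
  obtain ⟨m, hmm, hm, hm2⟩ := exists_pos_pow_le (max m₁ m₂) hε
  obtain ⟨C, f, hf, hfC, h⟩ := hσ.exists_approx hc (fun k => V k * y 0 k) (fun k => W k * y 1 k) hm
    (show (0 : ℝ) < ε / 128 by positivity)
  -- Only the `m` letters of the word must lie in a window: beyond them a size bound suffices, and
  -- `τ` is never larger than `σ`.
  refine upperDensity_pos_of_strictMono hf hfC m fun j hj => hball ?_
  have hsize : ∀ k, m ≤ k → (2 : ℝ) ^ pairSize β (τ (f j + k)) ≤ 2 ^ k := fun k hk =>
    pow_le_pow_right₀ one_le_two ((hτ₂ _).trans ((h j).2 k hk))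
  rw [Metric.mem_ball, dist_pi_lt_iff hε]
  refine Fin.forall_fin_two.2 ⟨?_, ?_⟩ <;> rw [directSumOp_pow_apply, dist_eq_norm]
  · refine norm_weightedShift_pow_sub_lt hp hV hv x (y 0)
      (hm₁ m ((le_max_left _ _).trans hmm)) hm2 (fun k hk => ?_) fun k hk => ?_
    · rw [hxV, hτ₁ _ (hj k hk)]
      exact ((h j).1 k hk).1
    · rw [hxV]
      exact (hc.norm_fst_le _).trans (hsize k hk)
  · refine norm_weightedShift_pow_sub_lt hp hW hw x (y 1)
      (hm₂ m ((le_max_right _ _).trans hmm)) hm2 (fun k hk => ?_) fun k hk => ?_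
    · rw [hxW, hτ₁ _ (hj k hk)]
      exact ((h j).1 k hk).2
    · rw [hxW]
      exact (hc.norm_snd_le _).trans (hsize k hk)

theorem not_areDisjointFrequentlyHypercyclic_weightedShift (hp : p ≠ ∞)
    {v w : lp (fun _ : ℕ => 𝕜) ∞} {V W : ℕ → 𝕜}
    (hV : ∀ i, V i ≠ 0) (hv : ∀ i, v (i + 1) = V (i + 1) / V i)
    (hW : ∀ i, W i ≠ 0) (hw : ∀ i, w (i + 1) = W (i + 1) / W i)
    (hVW : ∀ i ∉ factorialWindows, V i = W i) :
    ¬ AreDisjointFrequentlyHypercyclic ![weightedShift p hp v, weightedShift p hp w] := by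
  rintro ⟨x, hx⟩
  have hp0 : p ≠ 0 := (zero_lt_one.trans_le (Fact.out : 1 ≤ p)).ne'
  -- Outside the windows one scalar would be within `1 / 2` of both `1` and `2`.
  set y : Fin 2 → lp (fun _ : ℕ => 𝕜) p := ![lp.single p 0 1, lp.single p 0 2] with hy
  have hpos := hx (Metric.ball y (1 / 2)) Metric.isOpen_ball ⟨y, Metric.mem_ball_self (by norm_num)⟩
  refine absurd hpos (not_lt.2 (lowerDensity_nonpos_of_subset fun n hn => ?_))
  by_contra hnw
  rw [Set.mem_ofPred_eq, Metric.mem_ball, dist_pi_lt_iff (by norm_num)] at hn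
  have h0 := hn 0
  have h1 := hn 1
  rw [directSumOp_pow_apply, dist_eq_norm] at h0 h1
  replace h0 := (lp.norm_apply_le_norm hp0 _ 0).trans_lt h0
  replace h1 := (lp.norm_apply_le_norm hp0 _ 0).trans_lt h1
  rw [lp.coeFn_sub, Pi.sub_apply] at h0 h1
  have e0 : (y 0) 0 = 1 := by simp [hy]
  have e1 : (y 1) 0 = 2 := by simp [hy]
  rw [e0] at h0
  rw [e1] at h1
  simp only [Matrix.cons_val_zero, Matrix.cons_val_one] at h0 h1
  rw [weightedShift_pow_apply hp hV hv, add_zero] at h0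
  rw [weightedShift_pow_apply hp hW hw, add_zero, ← hVW n hnw,
    ← hVW 0 zero_notMem_factorialWindows] at h1
  have h := norm_sub_le (V n / V 0 * x n - 1) (V n / V 0 * x n - 2)
  rw [show V n / V 0 * x n - 1 - (V n / V 0 * x n - 2) = 1 by ring, norm_one] at h
  linarith

end DisjointShifts

/-! ### The pair of weights -/

theorem mainTheorem11 (𝕜 : Type*) [RCLike 𝕜] (p : ENNReal) [Fact (1 ≤ p)] (hp : p ≠ ⊤) :
    ∃ v w : lp (fun _ : ℕ => 𝕜) ⊤,
      IsFrequentlyHypercyclic (weightedShift p hp v) ∧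
      IsFrequentlyHypercyclic (weightedShift p hp w) ∧
      AreDisjointUpperFrequentlyHypercyclic ![weightedShift p hp v, weightedShift p hp w] ∧
      ¬ AreDisjointFrequentlyHypercyclic ![weightedShift p hp v, weightedShift p hp w] := by
  classical
  obtain ⟨c, β, hc⟩ := exists_isDenseAlphabet 𝕜
  obtain ⟨σ, hσ', hσ⟩ := exists_sequence_frequent_words (pairSize β) (none, none)
    (by simp [pairSize, hc.size_none])
  replace hσ : HasFrequentWords β σ := hσ
  set τ : ℕ → Option ℕ × Option ℕ := fun i => if i ∈ factorialWindows then σ i else (none, none)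
    with hτ
  have hτ₁ : ∀ i ∈ factorialWindows, τ i = σ i := fun i hi => if_pos hi
  have hτ₀ : ∀ i ∉ factorialWindows, τ i = (none, none) := fun i hi => if_neg hi
  have hτ₂ : ∀ i, pairSize β (τ i) ≤ pairSize β (σ i) := fun i => by
    by_cases hi : i ∈ factorialWindows
    · rw [hτ₁ i hi]
    · rw [hτ₀ i hi]; simp [pairSize, hc.size_none]
  set b : ℕ → ℕ := fun i => pairSize β (τ i) with hb
  have hb' : ∀ N, ∑ i ∈ Finset.range N, b i ≤ 2 * N := fun N =>
    (Finset.sum_le_sum fun i _ => hτ₂ i).trans (hσ' N)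
  set V : ℕ → 𝕜 := fun i =>
    c (τ i).1 * (256 ^ i / 2 ^ (∑ a ∈ Finset.range i, (b a + b (a + 1)))) with hVdef
  set W : ℕ → 𝕜 := fun i =>
    c (τ i).2 * (256 ^ i / 2 ^ (∑ a ∈ Finset.range i, (b a + b (a + 1)))) with hWdef
  have hV := le_norm_partial_product (fun i => hc.le_norm_fst (τ i)) hb' (V := V) fun _ => rfl
  have hW := le_norm_partial_product (fun i => hc.le_norm_snd (τ i)) hb' (V := W) fun _ => rfl
  have hV0 : ∀ i, V i ≠ 0 := fun i => norm_pos_iff.1 (lt_of_lt_of_le (by positivity) (hV i))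
  have hW0 : ∀ i, W i ≠ 0 := fun i => norm_pos_iff.1 (lt_of_lt_of_le (by positivity) (hW i))
  obtain ⟨v, hv⟩ := exists_weight (fun i => hc.norm_fst_le (τ i)) (fun i => hc.le_norm_fst (τ i))
    (V := V) fun _ => rfl
  obtain ⟨w, hw⟩ := exists_weight (fun i => hc.norm_snd_le (τ i)) (fun i => hc.le_norm_snd (τ i))
    (V := W) fun _ => rfl
  refine ⟨v, w, isFrequentlyHypercyclic_weightedShift hp hc hσ hσ' hV hv,
    isFrequentlyHypercyclic_weightedShift hp hc hσ hσ' hW hw,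
    areDisjointUpperFrequentlyHypercyclic_weightedShift hp hc hσ hτ₁ hτ₂ hV hv hW hw
      -- This vector is the reciprocal of the factor common to `V` and `W`, hence also equals `c (τ
      -- i).2 / W i`.
      ⟨fun i => c (τ i).1 / V i, memℓp_div_partial_product (fun i => hc.norm_fst_le (τ i)) hb' hV⟩
      (fun i => mul_div_cancel₀ _ (hV0 i)) (fun i => ?_),
    not_areDisjointFrequentlyHypercyclic_weightedShift hp hV0 hv hW0 hw fun i hi => ?_⟩
  · have h1 := hV0 i
    show W i * (c (τ i).1 / V i) = c (τ i).2
    rw [mul_div_assoc', div_eq_iff h1]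
    simp only [hVdef, hWdef]
    ring
  · simp only [hVdef, hWdef, hτ₀ i hi]
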